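/- For a rational number $b=n/m$ with $n,m$ coprime integers, let $H(b)=\max\{|n|,|m|\}$ be its multiplicative height. Let $b\in\mathbb{Q}$ with $H(b)\le 1000$, and let $\phi(x,y)=(y,\,x+y^2+b)$. If a point $P\in\mathbb{A}^2(\mathbb{Q})=\mathbb{Q}^2$ is periodic for $\phi$ with exact period $N$ (that is, $N\ge 1$ is the least positive integer with $\phi^N(P)=P$, where $\phi^N$ is the $N$-fold iterate), then $N\in\{1,2,3,4,6,8\}$. -/

import Mathlib

/-- The Hénon map `φ(x, y) = (y, x + y² + b)` on the `R`-points of the affine plane. -/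
def henonMap {R : Type*} [CommRing R] (b : R) (P : R × R) : R × R :=
  (P.2, P.1 + P.2 ^ 2 + b)

/-- For rational numbers, the multiplicative height is the maximum of the absolute values of
the numerator and the denominator in lowest terms. -/
theorem rat_mulHeight_eq_max (b : ℚ) :
    Height.mulHeight₁ b = max (b.num.natAbs : ℝ) (b.den : ℝ) := by
  rw [Rat.mulHeight₁_eq_max]
  push_cast
  rfl

/-! A periodic orbit has a least common denominator `d`. The recursion and minimality of `d` make
`-c / d ^ 2` the reduced form of `b`, so `d ≤ 31` and `|c| ≤ 1000` (`exists_common_denominator`). On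
the integer orbit `z`, let `M` be the maximum of `|z|`. At the extremal term `M ^ 2 - c` is `d`
times a difference of two terms, hence at most `2 * d * M`, which bounds `M`. That term and its two
neighbours determine `c` and the orbit, so finitely many cases remain, which the kernel checks
(`search_eq_true`). -/

/-! ### A kernel-friendly search

Integer orbits `z` of `d z (i + 2) = d z i + z (i + 1) ^ 2 - c` bounded by `M = |z 0|` are shifted
to `w i = z i + M`, which takes values in `[0, L]` with `L = 2 M`.  With
`d e = M ^ 2 - c` the recursion becomes `w (i + 2) + w (i + 1) (L - w (i + 1)) / d = w i + e`. -/

/-- `f` holds at every natural number below `n`. -/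
def allBelow (n : ℕ) (f : ℕ → Bool) : Bool :=
  Nat.rec true (fun k ih => f k && ih) n

theorem allBelow_apply {n : ℕ} {f : ℕ → Bool} (h : allBelow n f = true) {k : ℕ} (hk : k < n) :
    f k = true := by
  induction n with
  | zero => omega
  | succ n ih =>
    have h' : (f n && allBelow n f) = true := h
    rw [Bool.and_eq_true] at h'
    rcases Nat.lt_succ_iff_lt_or_eq.mp hk with hk | rfl
    · exact ih h'.2 hk
    · exact h'.1

/-- Follow the recursion from the consecutive values `a, b`; succeed if the orbit leaves `[0, L]` or
the integers, or if it comes back to `s, t` at a time dividing `6` or `8`. The operations are spelled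
`Nat.mul` and so on, because the kernel evaluates these without unfolding instances. -/
def orbitCloses (d e L s t m : ℕ) : ℕ → ℕ → ℕ → Bool :=
  Nat.rec (fun _ _ _ => false) (fun _ ih k a b =>
    bif Nat.beq (Nat.mod (Nat.mul b (Nat.sub L b)) d) 0 then
      bif Nat.ble (Nat.div (Nat.mul b (Nat.sub L b)) d) (Nat.add a e) then
        bif Nat.ble (Nat.sub (Nat.add a e) (Nat.div (Nat.mul b (Nat.sub L b)) d)) L then
          bif Nat.beq b s && Nat.beq (Nat.sub (Nat.add a e) (Nat.div (Nat.mul b (Nat.sub L b)) d)) t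
          then Nat.beq (Nat.mod 6 k) 0 || Nat.beq (Nat.mod 8 k) 0
          else ih (Nat.succ k) b (Nat.sub (Nat.add a e) (Nat.div (Nat.mul b (Nat.sub L b)) d))
        else true
      else true
    else true) m

theorem orbitCloses_succ {d e L s t m k a b q c : ℕ} (hd : 0 < d) (hq : b * (L - b) = d * q)
    (hc : c + q = a + e) (hL : c ≤ L) (h : orbitCloses d e L s t (m + 1) k a b = true) :
    (b = s ∧ c = t ∧ (k ∣ 6 ∨ k ∣ 8)) ∨ orbitCloses d e L s t m (k + 1) b c = true := by
  have h' : (bif Nat.beq (b * (L - b) % d) 0 then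
      bif Nat.ble (b * (L - b) / d) (a + e) then
        bif Nat.ble (a + e - b * (L - b) / d) L then
          bif Nat.beq b s && Nat.beq (a + e - b * (L - b) / d) t
          then Nat.beq (6 % k) 0 || Nat.beq (8 % k) 0
          else orbitCloses d e L s t m (k + 1) b (a + e - b * (L - b) / d)
        else true
      else true
    else true) = true := h
  have hsub : a + e - q = c := by omega
  have hle : q ≤ a + e := by omega
  rw [hq, Nat.mul_mod_right, Nat.mul_div_cancel_left q hd, hsub, Nat.ble_eq_true_of_le hle,
    Nat.ble_eq_true_of_le hL, Nat.beq_refl] at h'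
  simp only [cond_true] at h'
  by_cases hst : (Nat.beq b s && Nat.beq c t) = true
  · rw [hst, cond_true, Bool.or_eq_true] at h'
    rw [Bool.and_eq_true] at hst
    exact Or.inl ⟨Nat.eq_of_beq_eq_true hst.1, Nat.eq_of_beq_eq_true hst.2,
      h'.imp (fun h => Nat.dvd_of_mod_eq_zero (Nat.eq_of_beq_eq_true h))
        fun h => Nat.dvd_of_mod_eq_zero (Nat.eq_of_beq_eq_true h)⟩
  · rw [Bool.not_eq_true] at hst
    rw [hst] at h'
    exact Or.inr h'

/-- A genuine orbit stays integral and in `[0, L]`, and running out of fuel `m` yields `false`, so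
success can only come from a return. -/
theorem exists_return_of_orbitCloses {d e L : ℕ} (hd : 0 < d) {w : ℕ → ℕ} (hL : ∀ i, w i ≤ L)
    (hw : ∀ i, d * w (i + 2) + w (i + 1) * (L - w (i + 1)) = d * (w i + e)) (m k : ℕ)
    (h : orbitCloses d e L (w 0) (w 1) m (k + 1) (w k) (w (k + 1)) = true) :
    ∃ j, (j ∣ 6 ∨ j ∣ 8) ∧ w j = w 0 ∧ w (j + 1) = w 1 := by
  induction m generalizing k with
  | zero => exact absurd h Bool.false_ne_true
  | succ m ih =>
    have hk := hw k
    obtain ⟨q, hq⟩ : d ∣ w (k + 1) * (L - w (k + 1)) :=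
      (Nat.dvd_add_right (Dvd.intro _ rfl)).mp (hk ▸ Dvd.intro _ rfl)
    rw [hq, ← mul_add] at hk
    rcases orbitCloses_succ hd hq (Nat.eq_of_mul_eq_mul_left hd hk) (hL _) h with h | h
    · exact ⟨k + 1, h.2.2, h.1, h.2.1⟩
    · exact ih (k + 1) h

/-- All orbits with `M = |z 0|` and denominator `d` pass the test `orbitCloses`. Here `t` is the value
after, and `x` the value before, the extremal one, so that `e = t - x`. -/
def searchAt (d M : ℕ) : Bool :=
  allBelow (2 * M + 1) fun t =>
    bif Nat.beq (Nat.mod (Nat.mul t (Nat.sub (Nat.mul 2 M) t)) d) 0 then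
      allBelow (t + 1) fun x =>
        -- Since `c = M ^ 2 - d * (t - x)`, these two tests say `0 ≤ c ≤ 1000`.
        bif Nat.ble (Nat.mul d (Nat.sub t x)) (Nat.mul M M) then
        bif Nat.ble (Nat.mul M M) (Nat.add (Nat.mul d (Nat.sub t x)) 1000) then
        bif Nat.beq (Nat.mod (Nat.mul x (Nat.sub (Nat.mul 2 M) x)) d) 0 then
          -- The extremal value `-M` or `M` is shifted to `0` or `2 * M`.
          orbitCloses d (Nat.sub t x) (Nat.mul 2 M) 0 t 20 1 0 t &&
            orbitCloses d (Nat.sub t x) (Nat.mul 2 M) (Nat.mul 2 M) t 20 1 (Nat.mul 2 M) t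
        else true
        else true
        else true
    else true

def search : Bool :=
  allBelow 32 fun d => allBelow 76 fun M =>
    bif Nat.beq d 0 then true else
    bif Nat.beq (Nat.gcd M d) 1 && Nat.ble (M * M) (2 * d * M + 1000) then searchAt d M else true

theorem search_eq_true : search = true := by decide +kernel

theorem orbitCloses_of_search {d M t x : ℕ} (hd : 0 < d) (hd' : d < 32) (hM : M < 76)
    (hMd : Nat.Coprime M d) (hMM : M * M ≤ 2 * d * M + 1000) (ht : t ≤ 2 * M)
    (htd : d ∣ t * (2 * M - t)) (hx : x ≤ t) (hxd : d ∣ x * (2 * M - x))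
    (hc : d * (t - x) ≤ M * M) (hc' : M * M ≤ d * (t - x) + 1000) {s : ℕ}
    (hs : s = 0 ∨ s = 2 * M) :
    orbitCloses d (t - x) (2 * M) s t 20 1 s t = true := by
  have h := allBelow_apply (allBelow_apply search_eq_true hd') hM
  have beq {a b : ℕ} (h : a = b) : Nat.beq a b = true := by rw [h]; exact Nat.beq_refl b
  have hd0 : Nat.beq d 0 = false := by
    rw [Bool.eq_false_iff]
    exact fun h => hd.ne' (Nat.eq_of_beq_eq_true h)
  simp only [hd0, cond_false, beq hMd, Nat.ble_eq_true_of_le hMM, Bool.and_self, cond_true] at h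
  have h := allBelow_apply h (Nat.lt_succ_of_le ht)
  rw [show Nat.mod (Nat.mul t (Nat.sub (Nat.mul 2 M) t)) d = 0 from Nat.mod_eq_zero_of_dvd htd,
    Nat.beq_refl, cond_true] at h
  have h := allBelow_apply h (Nat.lt_succ_of_le hx)
  rw [show Nat.mod (Nat.mul x (Nat.sub (Nat.mul 2 M) x)) d = 0 from Nat.mod_eq_zero_of_dvd hxd,
    Nat.beq_refl, cond_true, show Nat.ble (Nat.mul M M) (Nat.add (Nat.mul d (Nat.sub t x)) 1000) = true from
      Nat.ble_eq_true_of_le hc', cond_true,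
    show Nat.ble (Nat.mul d (Nat.sub t x)) (Nat.mul M M) = true from
      Nat.ble_eq_true_of_le hc, cond_true, Bool.and_eq_true] at h
  rcases hs with rfl | rfl
  · exact h.1
  · exact h.2

/-! ### Integer orbits -/

/-- Used to exclude `c < 0` and `c > M ^ 2`, where `z (i + 2) - z i` would have constant sign. -/
theorem not_forall_lt_of_periodic {z : ℕ → ℤ} {N : ℕ} (hN : 0 < N) (hz : Function.Periodic z N) :
    ¬ ∀ i, z (i + 2) < z i := by
  intro h
  have hanti : StrictAnti fun i => z (2 * i) := strictAnti_nat_of_succ_lt fun i => h (2 * i)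
  have h1 := hanti hN
  have h2 : z (0 + N + N) = z 0 := by rw [hz, hz]
  rw [zero_add, ← two_mul] at h2
  simp only [mul_zero] at h1
  omega

/-- A periodic integer sequence with `d z (i + 2) = d z i + z (i + 1) ^ 2 - c` returns after `6` or
`8` steps, if `d ≤ 31` and `c ≤ 1000` are coprime. -/
theorem exists_return {z : ℕ → ℤ} {N d : ℕ} {c : ℤ} (hN : 0 < N) (hz : Function.Periodic z N)
    (hd : 0 < d) (hd' : d < 32) (hc : c ≤ 1000) (hcd : IsCoprime (d : ℤ) c)
    (h : ∀ i, (d : ℤ) * z (i + 2) = d * z i + z (i + 1) ^ 2 - c) :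
    ∃ k j, (j ∣ 6 ∨ j ∣ 8) ∧ z (k + j) = z k ∧ z (k + j + 1) = z (k + 1) := by
  have hd0 : (0 : ℤ) < d := by exact_mod_cast hd
  have hc0 : 0 ≤ c := by
    by_contra! hneg
    refine not_forall_lt_of_periodic hN (z := fun i => - z i) (fun i => by simp [hz i]) fun i => ?_
    have : (d : ℤ) * z i < d * z (i + 2) := by nlinarith [h i, sq_nonneg (z (i + 1))]
    simpa using lt_of_mul_lt_mul_left this hd0.le
  -- an index at which `|z|` is maximal
  obtain ⟨k, hk⟩ : ∃ k, ∀ i, |z i| ≤ |z (k + 1)| := by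
    obtain ⟨k, -, hk⟩ := (Finset.range N).exists_max_image (fun i => |z i|) ⟨0, by simpa using hN⟩
    -- Moving on by one period gives the extremal term a predecessor.
    refine ⟨k + N - 1, fun i => ?_⟩
    rw [show k + N - 1 + 1 = k + N by omega, hz k, ← hz.map_mod_nat i]
    exact hk _ (by simpa using Nat.mod_lt i hN)
  obtain ⟨M, hM⟩ : ∃ M : ℕ, |z (k + 1)| = M := ⟨_, Int.abs_eq_natAbs _⟩
  rw [hM] at hk
  have hlo (i) : -(M : ℤ) ≤ z i := (abs_le.mp (hk i)).1
  have hhi (i) : z i ≤ M := (abs_le.mp (hk i)).2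
  have hsq : z (k + 1) ^ 2 = (M : ℤ) ^ 2 := by rw [← hM, sq_abs]
  have hcM : c ≤ (M : ℤ) ^ 2 := by
    by_contra! hlt
    refine not_forall_lt_of_periodic hN hz fun i => ?_
    have h2 : z (i + 1) ^ 2 ≤ (M : ℤ) ^ 2 := by
      rw [← sq_abs]
      exact pow_le_pow_left₀ (abs_nonneg _) (hk _) 2
    exact lt_of_mul_lt_mul_left (by linarith [h i] : (d : ℤ) * z (i + 2) < d * z i) hd0.le
  -- shift to natural numbers
  choose w hw using fun i => Int.eq_ofNat_of_zero_le (by linarith [hlo i] : 0 ≤ z i + M)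
  have hwL (i) : w i ≤ 2 * M := by have := hw i; have := hhi i; omega
  have hk1 := h k
  have hxt : w k ≤ w (k + 2) := by
    have := hw k
    have := hw (k + 2)
    have : z k ≤ z (k + 2) := le_of_mul_le_mul_left (by linarith : (d : ℤ) * z k ≤ _) hd0
    omega
  have hce : (M : ℤ) ^ 2 - c = d * ((w (k + 2) - w k : ℕ) : ℤ) := by
    rw [Nat.cast_sub hxt]
    linear_combination (d : ℤ) * hw (k + 2) - (d : ℤ) * hw k - hk1 - hsq
  set e := w (k + 2) - w k with he
  have hrec (i) : d * w (i + 2) + w (i + 1) * (2 * M - w (i + 1)) = d * (w i + e) := by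
    zify [hwL (i + 1)]
    linear_combination h i - (d : ℤ) * hw (i + 2) + (d : ℤ) * hw i +
      hce + (z (i + 1) - M + w (i + 1)) * hw (i + 1)
  have hdvd (i) : d ∣ w i * (2 * M - w i) := by
    have h1 := hrec (i + (N - 1))
    have h2 : w (i + (N - 1) + 1) = w i := by
      have h3 := hw (i + (N - 1) + 1)
      rw [show i + (N - 1) + 1 = i + N by omega] at h3 ⊢
      rw [hz i, hw i] at h3
      exact_mod_cast h3.symm
    rw [h2] at h1
    exact (Nat.dvd_add_right (Dvd.intro _ rfl)).mp (h1 ▸ Dvd.intro _ rfl)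
  have hMM : M * M ≤ 2 * d * M + 1000 := by
    have h1 : (e : ℤ) ≤ 2 * M := by have := hwL (k + 2); omega
    zify
    nlinarith [mul_le_mul_of_nonneg_left h1 hd0.le]
  -- `M * (M - 62) ≤ 1000` fails from `76` on.
  have hM76 : M < 76 := by
    by_contra! hge
    have h31 : d * M ≤ 31 * M := Nat.mul_le_mul_right M (by omega)
    nlinarith
  have hcop : Nat.Coprime M d := by
    rw [← Nat.isCoprime_iff_coprime]
    have : IsCoprime ((M : ℤ) ^ 2) d := by
      have h1 := (hcd.symm.add_mul_left_left (e : ℤ))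
      rwa [show c + d * (e : ℤ) = (M : ℤ) ^ 2 by linarith] at h1
    exact (IsCoprime.pow_left_iff two_pos).mp this
  have hs : w (k + 1) = 0 ∨ w (k + 1) = 2 * M := by
    have := hw (k + 1)
    rcases abs_choice (z (k + 1)) with h1 | h1 <;> omega
  have key := orbitCloses_of_search hd hd' hM76 hcop hMM (hwL (k + 2)) (hdvd _) hxt (hdvd k)
    (by zify; linarith) (by zify; linarith) hs
  obtain ⟨j, hj, h1, h2⟩ := exists_return_of_orbitCloses hd (w := fun i => w (k + 1 + i))
    (fun i => hwL _) (fun i => hrec (k + 1 + i)) 20 0 key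
  refine ⟨k + 1, j, hj, ?_, ?_⟩
  · have := hw (k + 1 + j)
    have := hw (k + 1)
    simp only [add_zero] at h1
    omega
  · have := hw (k + 1 + (j + 1))
    have := hw (k + 1 + 1)
    rw [show k + 1 + j + 1 = k + 1 + (j + 1) by ring]
    omega

/-! ### Clearing denominators -/

/-- A periodic rational orbit has a common denominator `d` with `b = -c / d ^ 2` in lowest terms. -/
theorem exists_common_denominator {y : ℕ → ℚ} {N : ℕ} {b : ℚ} (hN : 0 < N)
    (hy : Function.Periodic y N) (h : ∀ i, y (i + 2) = y i + y (i + 1) ^ 2 + b) :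
    ∃ (d : ℕ) (c : ℤ) (z : ℕ → ℤ), 0 < d ∧ IsCoprime (d : ℤ) c ∧ b.num = -c ∧ b.den = d ^ 2 ∧
      ∀ i, d * y i = z i := by
  have hex : ∃ d : ℕ, 0 < d ∧ ∀ i, ∃ z : ℤ, d * y i = z := by
    refine ⟨∏ i ∈ Finset.range N, (y i).den, Finset.prod_pos fun i _ => (y i).den_pos, fun i => ?_⟩
    rw [← hy.map_mod_nat i]
    obtain ⟨q, hq⟩ := Finset.dvd_prod_of_mem (fun i => (y i).den)
      (Finset.mem_range.mpr (Nat.mod_lt i hN))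
    refine ⟨q * (y (i % N)).num, ?_⟩
    rw [hq]
    push_cast
    rw [mul_comm ((y (i % N)).den : ℚ), mul_assoc, Rat.den_mul_eq_num]
  classical
  obtain ⟨hd, hz⟩ := Nat.find_spec hex
  have hmin := fun m => Nat.find_min hex (m := m)
  set d := Nat.find hex
  choose z hz using hz
  have hdQ : (d : ℚ) ≠ 0 := by exact_mod_cast hd.ne'
  obtain ⟨c, hc⟩ : ∃ c : ℤ, c = z 1 ^ 2 + d * z 0 - d * z 2 := ⟨_, rfl⟩
  have hbc : (d : ℚ) ^ 2 * b = -c := by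
    rw [hc]
    push_cast
    rw [← hz, ← hz, ← hz, h 0]
    ring
  have hsq (i) : z (i + 1) ^ 2 = c + d * (z (i + 2) - z i) := by
    have : (z (i + 1) : ℚ) ^ 2 = c + d * (z (i + 2) - z i) := by
      rw [← hz, ← hz, ← hz, h i]
      linear_combination -hbc
    exact_mod_cast this
  -- A prime dividing `d` and `c` would divide every `z i`, so `d / p` would already clear
  -- denominators.
  have hcop : IsCoprime (d : ℤ) c := by
    rw [Int.isCoprime_iff_gcd_eq_one]
    by_contra hne
    obtain ⟨p, hp, hpg⟩ := Nat.exists_prime_and_dvd hne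
    have hpd : (p : ℤ) ∣ d := (Int.natCast_dvd_natCast.mpr hpg).trans (Int.gcd_dvd_left _ _)
    have hpc : (p : ℤ) ∣ c := (Int.natCast_dvd_natCast.mpr hpg).trans (Int.gcd_dvd_right _ _)
    obtain ⟨m, hm⟩ := Int.natCast_dvd_natCast.mp hpd
    have hm0 : 0 < m := Nat.pos_of_mul_pos_left (hm ▸ hd)
    have hpz (i) : (p : ℤ) ∣ z i := by
      have h1 : (p : ℤ) ∣ z (i + (N - 1) + 1) := by
        refine (Nat.prime_iff_prime_int.mp hp).dvd_of_dvd_pow (n := 2) ?_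
        rw [hsq]
        exact dvd_add hpc (hpd.mul_right _)
      have h2 : (z (i + N) : ℚ) = z i := by rw [← hz, ← hz, hy i]
      rw [show i + (N - 1) + 1 = i + N by omega] at h1
      rwa [show z (i + N) = z i by exact_mod_cast h2] at h1
    refine hmin m ?_ ⟨hm0, fun i => ?_⟩
    · rw [hm]
      exact lt_mul_of_one_lt_left hm0 hp.one_lt
    · obtain ⟨q, hq⟩ := hpz i
      refine ⟨q, mul_left_cancel₀ (by exact_mod_cast hp.ne_zero : (p : ℚ) ≠ 0) ?_⟩
      have h1 := hz i
      rw [hm, hq] at h1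
      push_cast at h1
      rw [← mul_assoc, h1]
  have hb : b = ((-c : ℤ) : ℚ) / ((d ^ 2 : ℤ) : ℚ) := by
    push_cast
    rw [eq_div_iff (pow_ne_zero 2 hdQ), ← hbc]
    ring
  have hpos : (0 : ℤ) < (d : ℤ) ^ 2 := by positivity
  have hcop2 : Nat.Coprime (-c).natAbs ((d : ℤ) ^ 2).natAbs := by
    rw [← Int.isCoprime_iff_nat_coprime]
    exact (hcop.pow_left (m := 2)).symm.neg_left
  refine ⟨d, c, z, hd, hcop, ?_, ?_, hz⟩
  · rw [hb, Rat.num_div_eq_of_coprime hpos hcop2]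
  · have h1 := Rat.den_div_eq_of_coprime hpos hcop2
    rw [← hb] at h1
    exact_mod_cast h1

/-! ### The theorem -/

theorem mem_of_dvd_six_or_eight {N : ℕ} (h : N ∣ 6 ∨ N ∣ 8) : N ∈ ({1, 2, 3, 4, 6, 8} : Set ℕ) := by
  have hN : N ≤ 8 := by
    rcases h with h | h
    · exact (Nat.le_of_dvd (by norm_num) h).trans (by norm_num)
    · exact Nat.le_of_dvd (by norm_num) h
  interval_cases N <;> revert h <;> simp

theorem mainTheorem6 (b : ℚ) (hb : Height.mulHeight₁ b ≤ 1000) (P : ℚ × ℚ) (N : ℕ)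
    (hN : 0 < N) (hP : Function.minimalPeriod (henonMap b) P = N) :
    N ∈ ({1, 2, 3, 4, 6, 8} : Set ℕ) := by
  rw [rat_mulHeight_eq_max, max_le_iff] at hb
  have hnum : b.num.natAbs ≤ 1000 := by exact_mod_cast hb.1
  have hden : b.den ≤ 1000 := by exact_mod_cast hb.2
  have hper : Function.IsPeriodicPt (henonMap b) N P := hP ▸ Function.isPeriodicPt_minimalPeriod _ _
  set y : ℕ → ℚ := fun i => ((henonMap b)^[i] P).1 with hy_def
  have hy1 (i) : ((henonMap b)^[i] P).2 = y (i + 1) := by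
    simp only [hy_def, Function.iterate_succ_apply', henonMap]
  have hrec (i) : y (i + 2) = y i + y (i + 1) ^ 2 + b := by
    rw [← hy1 (i + 1), ← hy1 i, Function.iterate_succ_apply']
    rfl
  have hy : Function.Periodic y N := fun i => by
    simp only [hy_def, Function.iterate_add_apply, hper.eq]
  obtain ⟨d, c, z, hd, hcop, hbn, hbd, hz⟩ := exists_common_denominator hN hy hrec
  have hdQ : (d : ℚ) ≠ 0 := by exact_mod_cast hd.ne'
  have hbc : b * d ^ 2 = -c := by
    have h1 := Rat.mul_den_eq_num b
    rw [hbn, hbd] at h1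
    exact_mod_cast h1
  have hzN : Function.Periodic z N := fun i => by
    have : (z (i + N) : ℚ) = z i := by rw [← hz, ← hz, hy i]
    exact_mod_cast this
  obtain ⟨k, j, hj, h1, h2⟩ := exists_return hN hzN hd (by nlinarith) (by omega) hcop fun i => by
    have : (d : ℚ) * z (i + 2) = d * z i + z (i + 1) ^ 2 - c := by
      rw [← hz, ← hz, ← hz, hrec i]
      linear_combination hbc
    exact_mod_cast this
  have hinj {i i' : ℕ} (h : z i = z i') : y i = y i' :=
    mul_left_cancel₀ hdQ (by rw [hz, hz, h])
  have hret : Function.IsPeriodicPt (henonMap b) j ((henonMap b)^[k] P) := by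
    rw [Function.IsPeriodicPt, Function.IsFixedPt, ← Function.iterate_add_apply, add_comm j k]
    exact Prod.ext (hinj h1) (by rw [hy1, hy1]; exact hinj h2)
  -- Points of one periodic orbit share their minimal period.
  have hdvd : N ∣ j := by
    rw [← hP, ← Function.minimalPeriod_apply_iterate (Function.mk_mem_periodicPts hN hper) k]
    exact hret.minimalPeriod_dvd
  exact mem_of_dvd_six_or_eight (hj.imp hdvd.trans hdvd.trans)
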